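/- \textbf{Setting.} Fix a base type $o$ of truth values and a countable set of further base types, called sorts. Types are built from $o$ and the sorts by forming function types $\sigma\tau$. There is a countable set of typed names: countably infinitely many variables of every type, and the logical constants $\neg:oo$, ${\to}:ooo$, $=_\sigma:\sigma\sigma o$ for every type $\sigma$, and $\forall_\alpha:(\alpha o)o$ for every sort $\alpha$. Terms are the simply typed $\lambda$-terms over these names; formulas are the terms of type $o$; $s\neq_\sigma t$ abbreviates $\neg(s=_\sigma t)$. Fix an arbitrary type-preserving operator $[\cdot]$ from terms to terms (for instance a $\beta$-normalization operator; no property of it is needed) and call a term $s$ normal if $[s]=s$. A branch is a set of normal formulas. A term is EFO if the only logical constants occurring in it are $\neg$, $\to$, and $=_\alpha$, $\forall_\alpha$ for sorts $\alpha$. A branch is EFO if each of its members is an EFO formula or a disequation $s\neq_\sigma t$ between EFO terms $s,t$ of an arbitrary type $\sigma$. A standard model of a set of formulas consists of nonempty domains $\mathcal D\alpha$ for the sorts $\alpha$, extended to all types by $\mathcal D o=\{0,1\}$ and $\mathcal D(\sigma\tau)=$ the set of all functions $\mathcal D\sigma\to\mathcal D\tau$, together with an assignment of an element of $\mathcal D\sigma$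 to every name of type $\sigma$ which interprets the logical constants in the usual way and under which every formula of the set evaluates to $1$. \textbf{Theorem.} Let $A$ be an EFO branch such that every finite subset of $A$ has a standard model. Then $A$ has a standard model in which $\mathcal D\alpha$ is countable (finite or countably infinite) for every sort $\alpha$. -/

import Mathlib

universe u w

namespace STT

/-- Simple types over a type `S` of sorts. The base types are the type `o` of truth values
and the sorts; `arr σ τ` is the type of functions from `σ` to `τ`. -/
inductive Ty (S : Type u) : Type u
  | o : Ty S
  | sort (α : S) : Ty S
  | arr (σ τ : Ty S) : Ty S

/-- Names, indexed by their type. For every type there are countably infinitely many variables;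
the remaining names are the logical constants: negation, implication, the identity predicate of
every type, and the universal quantifier of every sort. -/
inductive Name (S : Type u) : Ty S → Type u
  | var (σ : Ty S) (n : ℕ) : Name S σ
  | neg : Name S (.arr .o .o)
  | imp : Name S (.arr .o (.arr .o .o))
  | eq (σ : Ty S) : Name S (.arr σ (.arr σ .o))
  | all (α : S) : Name S (.arr (.arr (.sort α) .o) .o)

/-- Simply typed lambda terms with named bound names, indexed by their type. -/
inductive Term (S : Type u) : Ty S → Type u
  | name {σ : Ty S} (x : Name S σ) : Term S σ
  | app {σ τ : Ty S} (s : Term S (.arr σ τ)) (t : Term S σ) : Term S τ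
  | lam {σ τ : Ty S} (x : Name S σ) (s : Term S τ) : Term S (.arr σ τ)

/-- Formulas are the terms of type `o`. -/
abbrev Formula (S : Type u) : Type u := Term S Ty.o

/-- The disequation `s ≠ t`, that is, `¬ (s = t)`. -/
def Term.diseq {S : Type u} {σ : Ty S} (s t : Term S σ) : Formula S :=
  .app (.name .neg) (.app (.app (.name (.eq σ)) s) t)

/-! ### Standard semantics -/

/-- The standard frame whose sort domains are given by `D`: truth values at `o` (`Prop`, which has
exactly the two elements `False` and `True`), and full function spaces at function types. -/
def Ty.dom {S : Type u} (D : S → Type w) : Ty S → Type w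
  | .o => ULift.{w} Prop
  | .sort α => D α
  | .arr σ τ => σ.dom D → τ.dom D

/-- An assignment maps every name to a value of its type. -/
abbrev Assignment {S : Type u} (D : S → Type w) : Type (max u w) :=
  (x : Σ σ : Ty S, Name S σ) → x.1.dom D

open Classical in
/-- The assignment that agrees with `I` except that it maps `x` to `a`. -/
noncomputable def Assignment.update {S : Type u} {D : S → Type w} (I : Assignment D)
    {σ : Ty S} (x : Name S σ) (a : σ.dom D) : Assignment D :=
  Function.update I ⟨σ, x⟩ a

/-- The value of a term under an assignment into a standard frame. -/
noncomputable def Term.eval {S : Type u} {D : S → Type w} :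
    {σ : Ty S} → Term S σ → Assignment D → σ.dom D
  | σ, .name x, I => I ⟨σ, x⟩
  | _, .app s t, I => (s.eval I) (t.eval I)
  | _, .lam x s, I => fun a => s.eval (I.update x a)

/-- An assignment is logical if it interprets the logical constants as usual. -/
structure Assignment.IsLogical {S : Type u} {D : S → Type w} (I : Assignment D) : Prop where
  neg : I ⟨_, Name.neg⟩ = fun a : ULift.{w} Prop => ULift.up (¬ a.down)
  imp : I ⟨_, Name.imp⟩ = fun a b : ULift.{w} Prop => ULift.up (a.down → b.down)
  eq : ∀ σ : Ty S, I ⟨_, Name.eq σ⟩ = fun a b : σ.dom D => ULift.up (a = b)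
  all : ∀ α : S, I ⟨_, Name.all α⟩ = fun f : D α → ULift.{w} Prop => ULift.up (∀ a, (f a).down)

/-- A standard logical interpretation: a standard frame (all of whose domains are nonempty)
with a logical assignment into it. -/
structure StandardInterpretation (S : Type u) : Type (max u (w + 1)) where
  dom : S → Type w
  nonempty : ∀ α, Nonempty (dom α)
  val : Assignment dom
  logical : val.IsLogical

/-- The interpretation `I` is a model of a set of formulas: it makes all of them true. -/
def StandardInterpretation.IsModel {S : Type u} (I : StandardInterpretation.{u, w} S)
    (A : Set (Formula S)) : Prop :=
  ∀ s ∈ A, (s.eval I.val : ULift.{w} Prop).down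

/-! ### The extended first-order fragment -/

/-- The names admitted in EFO terms: everything except the identity predicates
of types that are not sorts. -/
def Name.IsEFO {S : Type u} : {σ : Ty S} → Name S σ → Prop
  | _, .var _ _ => True
  | _, .neg => True
  | _, .imp => True
  | _, .eq σ => ∃ α : S, σ = .sort α
  | _, .all _ => True

/-- A term is EFO if its only logical constants are `¬`, `→`, and `=` and `∀` at sorts. -/
def Term.IsEFO {S : Type u} : {σ : Ty S} → Term S σ → Prop
  | _, .name x => x.IsEFO
  | _, .app s t => s.IsEFO ∧ t.IsEFO
  | _, .lam x s => x.IsEFO ∧ s.IsEFO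

/-- A formula is quasi-EFO if it is EFO or a disequation, at any type, between EFO terms. -/
def IsQuasiEFO {S : Type u} (s : Formula S) : Prop :=
  s.IsEFO ∨ ∃ (σ : Ty S) (t v : Term S σ), t.IsEFO ∧ v.IsEFO ∧ s = Term.diseq t v

/-- A branch is a set of normal formulas, where a term is normal if the type preserving
operator `nf` on terms fixes it. -/
def IsBranch {S : Type u} (nf : ∀ σ : Ty S, Term S σ → Term S σ) (A : Set (Formula S)) : Prop :=
  ∀ s ∈ A, nf Ty.o s = s

/-- A branch is EFO if all its members are quasi-EFO. -/
def IsEFOBranch {S : Type u} (nf : ∀ σ : Ty S, Term S σ → Term S σ)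
    (A : Set (Formula S)) : Prop :=
  IsBranch nf A ∧ ∀ s ∈ A, IsQuasiEFO s

end STT

/-! Compactness and countability come from one construction: a Löwenheim–Skolem argument inside an
ultraproduct. Models of the finite subsets of the branch form a family of standard frames. In their
product, `exists_countable_isElementary` finds a countable subfamily `N` closed under term
evaluation and containing witnesses of extensionality. The new sorts are `N` modulo equality almost
everywhere, and the full function spaces over them give a standard frame. The function spaces of
this frame may contain more than `N` does, so the two are compared by the logical relation
`Represents`. By `represents_partial_surjection` it is a partial function, modulo almost everywhere
equality, onto `N`. Constants admitted in EFO terms are related to their families, so EFO formulas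
transfer. At higher types one family may have several representatives, but equal representatives
force almost equal families; hence disequations transfer there although equations need not. -/

namespace STT

/-! ### Countability of the syntax -/

section Countability

variable {S : Type u}

/-- The height of a type as a tree. -/
def Ty.height : Ty S → ℕ
  | .o => 0
  | .sort _ => 0
  | .arr σ τ => max σ.height τ.height + 1

theorem Ty.countable_height_lt [Countable S] (n : ℕ) : {σ : Ty S | σ.height < n}.Countable := by
  induction n with
  | zero => simp
  | succ n ih =>
    refine (((Set.countable_singleton Ty.o).union (Set.countable_range Ty.sort)).union
      (ih.image2 ih Ty.arr)).mono ?_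
    rintro (_ | α | ⟨σ, τ⟩) h
    · exact .inl (.inl rfl)
    · exact .inl (.inr ⟨α, rfl⟩)
    · have h' : max σ.height τ.height + 1 < n + 1 := h
      exact .inr ⟨σ, show σ.height < n by omega, τ, show τ.height < n by omega, rfl⟩

instance Ty.instCountable [Countable S] : Countable (Ty S) := by
  rw [← Set.countable_univ_iff]
  refine (Set.countable_iUnion (Ty.countable_height_lt (S := S))).mono fun σ _ => ?_
  exact Set.mem_iUnion.2 ⟨σ.height + 1, Nat.lt_succ_self _⟩

/-- A numbering of the names of each type. -/
def Name.code : {σ : Ty S} → Name S σ → ℕ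
  | _, .neg => 0
  | _, .imp => 1
  | _, .eq _ => 2
  | _, .all _ => 3
  | _, .var _ n => n + 4

instance Name.instCountable (σ : Ty S) : Countable (Name S σ) := by
  refine Function.Injective.countable (f := Name.code) fun x y h => ?_
  cases x <;> cases y <;> simp_all [Name.code]

/-- The height of a term as a tree. -/
def Term.height : {σ : Ty S} → Term S σ → ℕ
  | _, .name _ => 0
  | _, .app s t => max s.height t.height + 1
  | _, .lam _ s => s.height + 1

theorem Term.countable_height_lt [Countable S] (n : ℕ) (σ : Ty S) :
    {s : Term S σ | s.height < n}.Countable := by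
  induction n generalizing σ with
  | zero => simp
  | succ n ih =>
    have happ : (⋃ τ, Set.image2 (Term.app (σ := τ) (τ := σ))
        {s | s.height < n} {t | t.height < n}).Countable :=
      Set.countable_iUnion fun τ => (ih _).image2 (ih _) _
    have hlam : (⋃ (τ : Ty S) (ρ : Ty S) (h : Ty.arr τ ρ = σ),
        Set.image2 (fun (x : Name S τ) (s : Term S ρ) => h ▸ Term.lam x s)
          Set.univ {s | s.height < n}).Countable :=
      Set.countable_iUnion fun τ => Set.countable_iUnion fun ρ => Set.countable_iUnion fun h =>
        Set.countable_univ.image2 (ih _) _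
    refine (((Set.countable_range Term.name).union happ).union hlam).mono ?_
    intro s h
    cases s with
    | name x => exact .inl (.inl ⟨x, rfl⟩)
    | @app τ _ s t =>
      have h' : max s.height t.height + 1 < n + 1 := h
      exact .inl (.inr (Set.mem_iUnion.2
        ⟨τ, s, show s.height < n by omega, t, show t.height < n by omega, rfl⟩))
    | @lam τ ρ x s =>
      have h' : s.height + 1 < n + 1 := h
      refine .inr (Set.mem_iUnion.2 ⟨τ, Set.mem_iUnion.2 ⟨ρ, Set.mem_iUnion.2 ⟨rfl, ?_⟩⟩⟩)
      exact ⟨x, trivial, s, show s.height < n by omega, rfl⟩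

instance Term.instCountable [Countable S] (σ : Ty S) : Countable (Term S σ) := by
  rw [← Set.countable_univ_iff]
  refine (Set.countable_iUnion fun n => Term.countable_height_lt (S := S) n σ).mono fun s _ => ?_
  exact Set.mem_iUnion.2 ⟨s.height + 1, Nat.lt_succ_self _⟩

end Countability

/-! ### Families of standard frames -/

theorem Assignment.update_self {S : Type u} {D : S → Type w} (I : Assignment D) {σ : Ty S}
    (x : Name S σ) (a : σ.dom D) : I.update x a ⟨σ, x⟩ = a :=
  by classical exact Function.update_self _ _ _

theorem Assignment.update_of_ne {S : Type u} {D : S → Type w} (I : Assignment D) {σ : Ty S}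
    {x : Name S σ} (a : σ.dom D) {y : Σ σ : Ty S, Name S σ} (h : y ≠ ⟨σ, x⟩) :
    I.update x a y = I y :=
  by classical exact Function.update_of_ne h _ _

theorem Ty.dom_nonempty {S : Type u} {D : S → Type w} (h : ∀ α, Nonempty (D α)) :
    ∀ σ : Ty S, Nonempty (σ.dom D)
  | .o => ⟨ULift.up True⟩
  | .sort α => h α
  | .arr _ τ => (Ty.dom_nonempty h τ).map fun b _ => b

section Family

variable {S : Type u} {ι : Type*} {D : ι → S → Type w}

/-- The product over `i` of the domains at type `σ` of the frames given by `D i`. -/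
abbrev Ty.family (D : ι → S → Type w) (σ : Ty S) := (i : ι) → σ.dom (D i)

/-- A valuation is a family of assignments, one for each frame. -/
abbrev Valuation (D : ι → S → Type w) := (x : Σ σ : Ty S, Name S σ) → x.1.family D

/-- The `i`-th assignment of a valuation. -/
def Valuation.proj (ψ : Valuation D) (i : ι) : Assignment (D i) := fun x => ψ x i

open Classical in
/-- The valuation that agrees with `ψ` except that it maps `x` to `b`. -/
noncomputable def Valuation.update (ψ : Valuation D) {σ : Ty S} (x : Name S σ)
    (b : σ.family D) : Valuation D :=
  Function.update ψ ⟨σ, x⟩ b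

theorem Valuation.update_self (ψ : Valuation D) {σ : Ty S} (x : Name S σ) (b : σ.family D) :
    ψ.update x b ⟨σ, x⟩ = b :=
  by classical exact Function.update_self _ _ _

theorem Valuation.update_of_ne (ψ : Valuation D) {σ : Ty S} {x : Name S σ} (b : σ.family D)
    {y : Σ σ : Ty S, Name S σ} (h : y ≠ ⟨σ, x⟩) : ψ.update x b y = ψ y :=
  by classical exact Function.update_of_ne h _ _

theorem Valuation.proj_update (ψ : Valuation D) {σ : Ty S} (x : Name S σ) (b : σ.family D)
    (i : ι) : (ψ.update x b).proj i = (ψ.proj i).update x (b i) := by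
  funext y
  by_cases h : y = ⟨σ, x⟩
  · subst h
    simp [Valuation.proj, Valuation.update_self, Assignment.update_self]
  · simp [Valuation.proj, Valuation.update_of_ne _ _ h, Assignment.update_of_ne _ _ h]

/-- The value of a term under a valuation, computed in each frame separately. -/
noncomputable def Term.evalFamily {σ : Ty S} (s : Term S σ) (ψ : Valuation D) : σ.family D :=
  fun i => s.eval (ψ.proj i)

/-- The valuations obtained from `ψ` by finitely many updates with values in `N`. -/
inductive FiniteVariant (ψ : Valuation D) (N : (σ : Ty S) → Set (σ.family D)) :
    Valuation D → Prop
  | base : FiniteVariant ψ N ψ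
  | update {φ : Valuation D} {σ : Ty S} (x : Name S σ) (b : σ.family D) :
      FiniteVariant ψ N φ → b ∈ N σ → FiniteVariant ψ N (φ.update x b)

theorem FiniteVariant.mono {ψ φ : Valuation D} {N N' : (σ : Ty S) → Set (σ.family D)}
    (hN : ∀ σ, N σ ⊆ N' σ) (h : FiniteVariant ψ N φ) : FiniteVariant ψ N' φ := by
  induction h with
  | base => exact .base
  | update x b _ hb ih => exact .update x b ih (hN _ hb)

/-- A finite variant is coded by the list of its updates. -/
theorem FiniteVariant.countable [Countable S] (ψ : Valuation D)
    {N : (σ : Ty S) → Set (σ.family D)} (hN : ∀ σ, (N σ).Countable) :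
    {φ | FiniteVariant ψ N φ}.Countable := by
  classical
  have (σ : Ty S) : Countable (N σ) := (hN σ).to_subtype
  refine (Set.countable_range fun l : List (Σ x : (Σ σ : Ty S, Name S σ), N x.1) =>
    l.foldr (fun p φ => Valuation.update φ p.1.2 p.2.1) ψ).mono ?_
  intro φ h
  induction h with
  | base => exact ⟨[], rfl⟩
  | update x b _ hb ih =>
    obtain ⟨l, rfl⟩ := ih
    exact ⟨⟨⟨_, x⟩, b, hb⟩ :: l, rfl⟩

/-- A subfamily of the product of the frames is elementary over the valuation `ψ` if it contains
the values of all terms under finite variants of `ψ` and is extensional. -/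
structure IsElementary (ψ : Valuation D) (N : (σ : Ty S) → Set (σ.family D)) : Prop where
  eval_mem : ∀ {σ : Ty S} (s : Term S σ) {φ : Valuation D}, FiniteVariant ψ N φ →
    s.evalFamily φ ∈ N σ
  exists_ext : ∀ {σ τ : Ty S} {g g' : (Ty.arr σ τ).family D}, g ∈ N _ → g' ∈ N _ →
    ∃ b ∈ N σ, ∀ i, g i (b i) = g' i (b i) → g i = g' i

theorem exists_ext_witness (hD : ∀ i α, Nonempty (D i α)) {σ τ : Ty S}
    (g g' : (Ty.arr σ τ).family D) :
    ∃ b : σ.family D, ∀ i, g i (b i) = g' i (b i) → g i = g' i := by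
  have h (i : ι) : ∃ a : σ.dom (D i), g i a = g' i a → g i = g' i := by
    by_contra! h
    obtain ⟨a⟩ := Ty.dom_nonempty (hD i) σ
    exact (h a).2 (funext fun a => (h a).1)
  choose b hb using h
  exact ⟨b, hb⟩

/-- A Skolem hull: starting from nothing, add term values and chosen extensionality witnesses, and
take the union over all stages. A finite variant uses finitely many values, so it already lives at
some stage. -/
theorem exists_countable_isElementary [Countable S] (hD : ∀ i α, Nonempty (D i α))
    (ψ : Valuation D) :
    ∃ N : (σ : Ty S) → Set (σ.family D), (∀ σ, (N σ).Countable) ∧ IsElementary ψ N := by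
  choose ext hext using fun σ τ => exists_ext_witness hD (σ := σ) (τ := τ)
  let step (N : (σ : Ty S) → Set (σ.family D)) (σ : Ty S) : Set (σ.family D) :=
    N σ ∪ (Set.image2 (fun (s : Term S σ) φ => s.evalFamily φ) Set.univ {φ | FiniteVariant ψ N φ} ∪
      ⋃ τ, Set.image2 (ext σ τ) (N _) (N _))
  let M (n : ℕ) : (σ : Ty S) → Set (σ.family D) := step^[n] fun _ => ∅
  have hsucc (n : ℕ) : M (n + 1) = step (M n) := Function.iterate_succ_apply' _ _ _
  have hmono {m n : ℕ} (h : m ≤ n) (σ : Ty S) : M m σ ⊆ M n σ := by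
    induction h with
    | refl => exact subset_rfl
    | step _ ih =>
      refine ih.trans ?_
      rw [hsucc]
      exact Set.subset_union_left
  have hcount (n : ℕ) : ∀ σ, (M n σ).Countable := by
    induction n with
    | zero => exact fun σ => Set.countable_empty
    | succ n ih =>
      intro σ
      rw [hsucc]
      exact (ih σ).union ((Set.countable_univ.image2 (FiniteVariant.countable ψ ih) _).union
        (Set.countable_iUnion fun τ => (ih _).image2 (ih _) _))
  refine ⟨fun σ => ⋃ n, M n σ, fun σ => Set.countable_iUnion fun n => hcount n σ, ?_, ?_⟩
  · intro σ s φ hφ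
    have : ∃ n, FiniteVariant ψ (M n) φ := by
      induction hφ with
      | base => exact ⟨0, .base⟩
      | update x b _ hb ih =>
        obtain ⟨m, hm⟩ := ih
        obtain ⟨n, hn⟩ := Set.mem_iUnion.1 hb
        exact ⟨max m n, .update x b (hm.mono (hmono (le_max_left _ _)))
          (hmono (le_max_right _ _) _ hn)⟩
    obtain ⟨n, hn⟩ := this
    refine Set.mem_iUnion.2 ⟨n + 1, ?_⟩
    rw [hsucc]
    exact .inr (.inl ⟨s, trivial, φ, hn, rfl⟩)
  · intro σ τ g g' hg hg'
    obtain ⟨m, hm⟩ := Set.mem_iUnion.1 hg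
    obtain ⟨n, hn⟩ := Set.mem_iUnion.1 hg'
    refine ⟨ext σ τ g g', Set.mem_iUnion.2 ⟨max m n + 1, ?_⟩, hext σ τ g g'⟩
    rw [hsucc]
    exact .inr (.inr (Set.mem_iUnion.2 ⟨τ, g, hmono (le_max_left _ _) _ hm,
      g', hmono (le_max_right _ _) _ hn, rfl⟩))

theorem IsElementary.app_mem {ψ : Valuation D} {N : (σ : Ty S) → Set (σ.family D)}
    (h : IsElementary ψ N) {σ τ : Ty S} {g : (Ty.arr σ τ).family D} {b : σ.family D}
    (hg : g ∈ N _) (hb : b ∈ N _) : (fun i => g i (b i) : τ.family D) ∈ N τ := by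
  -- Application is the value of a term applying one variable to another; the distinct indices 0 and
  -- 1 let `Name.code` separate the two variables.
  have := h.eval_mem (.app (.name (.var (.arr σ τ) 0)) (.name (.var σ 1)))
    (.update (.var σ 1) b (.update (.var (.arr σ τ) 0) g .base hg) hb)
  convert this using 1
  have hne : (⟨.arr σ τ, .var _ 0⟩ : Σ σ : Ty S, Name S σ) ≠ ⟨σ, .var _ 1⟩ := by
    intro h
    have := congrArg (fun x : Σ σ : Ty S, Name S σ => x.2.code) h
    simp [Name.code] at this
  funext i
  simp only [Term.evalFamily, Term.eval, Valuation.proj, Valuation.update_self,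
    Valuation.update_of_ne _ _ hne]

/-! ### Countable quotients -/

theorem exists_countable_transversal {X : Type*} (r : Setoid X) {s : Set X} (hs : s.Countable) :
    ∃ (Q : Type w) (e : Q → X), Countable Q ∧ (∀ a, e a ∈ s) ∧ (∀ a a', r (e a) (e a') → a = a') ∧
      ∀ b ∈ s, ∃ a, r (e a) b := by
  have : Countable s := hs.to_subtype
  let q := Quotient (r.comap ((↑) : s → X))
  have : Countable q := inferInstance
  -- The quotient lives in the universe of `X`; being countable, it can be moved to `w`, where the
  -- sort domains must lie.
  have : Small.{w} q := Countable.toSmall q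
  have : Countable (Shrink.{w} q) := (equivShrink q).symm.injective.countable
  refine ⟨Shrink.{w} q, fun a => ((equivShrink q).symm a).out, inferInstance,
    fun a => Subtype.coe_prop _, fun a a' h => ?_, fun b hb => ⟨equivShrink q ⟦⟨b, hb⟩⟧, ?_⟩⟩
  · exact (equivShrink q).symm.injective (Quotient.out_equiv_out.1 h)
  · simp only [Equiv.symm_apply_apply]
    exact Quotient.mk_out (s := r.comap ((↑) : s → X)) ⟨b, hb⟩

/-- The values `b` and `b'` agree almost everywhere. -/
def almostEqual (U : Ultrafilter ι) (σ : Ty S) : Setoid (σ.family D) where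
  r b b' := ∀ᶠ i in (U : Filter ι), b i = b' i
  iseqv :=
    { refl := fun _ => .of_forall fun _ => rfl
      symm := fun h => h.mono fun _ h => h.symm
      trans := fun h h' => by filter_upwards [h, h'] with i h h' using h.trans h' }

/-! ### The logical relation -/

variable (U : Ultrafilter ι) (N : (σ : Ty S) → Set (σ.family D)) {E : S → Type w}
  (e : (α : S) → E α → (Ty.sort α).family D)

/-- The logical relation between a standard frame and the subfamily `N` of a product of standard
frames that is given by almost everywhere equality to `e a` at the sorts. -/
def Represents : (σ : Ty S) → σ.dom E → σ.family D → Prop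
  | .o, p, b => p.down ↔ ∀ᶠ i in (U : Filter ι), (b i : ULift.{w} Prop).down
  | .sort α, a, b => almostEqual U (.sort α) (e α a) b
  | .arr σ τ, f, g => ∀ (a : σ.dom E) (b : σ.family D), b ∈ N σ → Represents σ a b →
      Represents τ (f a) fun i => g i (b i)

/-- The sorts of the frame `E` represent the classes of `N` modulo almost everywhere equality. -/
structure IsTransversal : Prop where
  mem : ∀ α a, e α a ∈ N (.sort α)
  inj : ∀ α a a', almostEqual U (.sort α) (e α a) (e α a') → a = a'
  surj : ∀ α, ∀ b ∈ N (.sort α), ∃ a, almostEqual U (.sort α) (e α a) b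

variable {U N e} {ψ : Valuation D}

theorem Represents.congr {σ : Ty S} {a : σ.dom E} {b b' : σ.family D}
    (h : Represents U N e σ a b) (hb : almostEqual U σ b b') : Represents U N e σ a b' := by
  induction σ with
  | o =>
    have hb : ∀ᶠ i in (U : Filter ι), b i = b' i := hb
    exact h.trans (Filter.eventually_congr (hb.mono fun i h => by rw [h]))
  | sort α => exact (almostEqual U _).trans h hb
  | arr σ τ _ ih =>
    have hb : ∀ᶠ i in (U : Filter ι), b i = b' i := hb
    exact fun a c hc hac => ih (h a c hc hac) (hb.mono fun i h => congrFun h (c i))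

/-- The two halves need a joint induction: at a function type, uniqueness uses that the
extensionality witness has a representative, and existence uses uniqueness at the argument type. -/
theorem represents_partial_surjection (hN : IsElementary ψ N) (he : IsTransversal U N e)
    (hE : ∀ α, Nonempty (E α)) (σ : Ty S) :
    (∀ a, ∀ b ∈ N σ, ∀ b' ∈ N σ, Represents U N e σ a b → Represents U N e σ a b' →
      almostEqual U σ b b') ∧ ∀ b ∈ N σ, ∃ a, Represents U N e σ a b := by
  induction σ with
  | o =>
    refine ⟨fun p b _ b' _ h h' => ?_, fun b _ => ⟨ULift.up (∀ᶠ i in (U : Filter ι),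
      (b i : ULift.{w} Prop).down), Iff.rfl⟩⟩
    have key : ∀ᶠ i in (U : Filter ι),
        ((b i : ULift.{w} Prop).down ↔ (b' i : ULift.{w} Prop).down) := by
      have hbb := h.symm.trans h'
      by_cases hb : ∀ᶠ i in (U : Filter ι), (b i : ULift.{w} Prop).down
      · filter_upwards [hb, hbb.1 hb] with i h h' using iff_of_true h h'
      · filter_upwards [Ultrafilter.eventually_not.2 hb,
          Ultrafilter.eventually_not.2 (fun h => hb (hbb.2 h))] with i h h' using iff_of_false h h'
    exact key.mono fun i h => ULift.ext _ _ (propext h)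
  | sort α =>
    exact ⟨fun a b _ b' _ h h' => (almostEqual U _).trans ((almostEqual U _).symm h) h',
      he.surj α⟩
  | arr σ τ ihσ ihτ =>
    constructor
    · intro f g hg g' hg' h h'
      obtain ⟨b, hb, hext⟩ := hN.exists_ext hg hg'
      obtain ⟨a, ha⟩ := ihσ.2 b hb
      have := ihτ.1 (f a) _ (hN.app_mem hg hb) _ (hN.app_mem hg' hb) (h a b hb ha) (h' a b hb ha)
      exact Filter.Eventually.mono this hext
    · intro g hg
      have h (a : σ.dom E) : ∃ c : τ.dom E, ∀ b ∈ N σ, Represents U N e σ a b →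
          Represents U N e τ c fun i => g i (b i) := by
        -- Arguments that represent nothing in `N` may be sent to any value.
        by_cases ha : ∃ b ∈ N σ, Represents U N e σ a b
        · obtain ⟨b₀, hb₀, hab₀⟩ := ha
          obtain ⟨c, hc⟩ := ihτ.2 _ (hN.app_mem hg hb₀)
          refine ⟨c, fun b hb hab => hc.congr ?_⟩
          have := ihσ.1 a b₀ hb₀ b hb hab₀ hab
          exact Filter.Eventually.mono this fun i h => congrArg (g i) h
        · obtain ⟨c⟩ := Ty.dom_nonempty hE τ
          exact ⟨c, fun b hb h => (ha ⟨b, hb, h⟩).elim⟩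
      choose f hf using h
      exact ⟨f, hf⟩

/-- The fundamental property of the logical relation. -/
theorem Term.IsEFO.represents_eval (hN : IsElementary ψ N) {σ : Ty S} {s : Term S σ}
    (hs : s.IsEFO) {θ : Assignment E} {φ : Valuation D} (hφ : FiniteVariant ψ N φ)
    (hθ : ∀ (τ : Ty S) (x : Name S τ), x.IsEFO → Represents U N e τ (θ ⟨τ, x⟩) (φ ⟨τ, x⟩)) :
    Represents U N e σ (s.eval θ) (s.evalFamily φ) := by
  induction s generalizing θ φ with
  | name x => exact hθ _ x hs
  | app s t ihs iht =>
    exact ihs hs.1 hφ hθ _ _ (hN.eval_mem t hφ) (iht hs.2 hφ hθ)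
  | @lam τ ρ x s ih =>
    intro a b hb hab
    have key := ih hs.2 (θ := θ.update x a) (.update x b hφ hb) fun τ' y hy => by
      by_cases h : (⟨τ', y⟩ : Σ σ : Ty S, Name S σ) = ⟨τ, x⟩
      · cases h
        simpa only [Assignment.update_self, Valuation.update_self] using hab
      · simpa only [Assignment.update_of_ne _ _ h, Valuation.update_of_ne _ _ h] using hθ τ' y hy
    convert key using 1
    · rfl
    · funext i
      simp only [Term.evalFamily, Valuation.proj_update]
      rfl

/-- The quantifier ranges over a whole domain while `N` supplies only some elements. The
extensionality witness against the constantly true predicate is a potential counterexample lying in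
`N`, so testing it suffices. -/
theorem represents_all (hN : IsElementary ψ N) (he : IsTransversal U N e)
    (hψ : ∀ i, (ψ.proj i).IsLogical) (α : S) :
    Represents U N e (.arr (.arr (.sort α) .o) .o)
      (fun f : E α → ULift.{w} Prop => ULift.up (∀ a, (f a).down)) (ψ ⟨_, .all α⟩) := by
  intro f g hg hfg
  have hall (i : ι) : ψ ⟨_, .all α⟩ i =
      fun f : D i α → ULift.{w} Prop => ULift.up (∀ a, (f a).down) := (hψ i).all α
  have hiff : (ULift.up.{w} (∀ a, (f a : ULift.{w} Prop).down)).down ↔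
      ∀ᶠ i in (U : Filter ι), ∀ a : D i α, (g i a : ULift.{w} Prop).down := by
    constructor
    · intro hf
      -- The term `λ x, x = x` puts the constantly true predicate into `N`.
      let x : Name S (.sort α) := .var _ 0
      let t : Term S (.arr (.sort α) .o) :=
        .lam x (.app (.app (.name (.eq (.sort α))) (.name x)) (.name x))
      have ht (i : ι) (a : D i α) : t.evalFamily ψ i a = ULift.up True := by
        have hne : (⟨_, .eq (.sort α)⟩ : Σ σ : Ty S, Name S σ) ≠ ⟨_, x⟩ := by
          intro h
          simp [x] at h
        have heq : (ψ.proj i).update x a ⟨_, .eq (.sort α)⟩ =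
            fun a b : (Ty.sort α).dom (D i) => ULift.up (a = b) :=
          (Assignment.update_of_ne _ _ hne).trans ((hψ i).eq (.sort α))
        refine (congrFun (congrFun heq _) _).trans ?_
        exact ULift.ext _ _ (eq_self _)
      obtain ⟨b, hb, hext⟩ := hN.exists_ext hg (hN.eval_mem t .base)
      obtain ⟨a, ha⟩ := he.surj α b hb
      have hfa := (hfg a b hb ha).1 (hf a)
      filter_upwards [hfa] with i hi a'
      have h : g i = t.evalFamily ψ i :=
        hext i ((ULift.ext _ _ (eq_true hi)).trans (ht i (b i)).symm)
      exact of_eq_true (congrArg ULift.down ((congrFun h a').trans (ht i a')))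
    · intro hg' a
      exact (hfg a (e α a) (he.mem α a) ((almostEqual U _).refl _)).2
        (hg'.mono fun i h => h (e α a i))
  refine hiff.trans (Filter.eventually_congr (.of_forall fun i => ?_))
  exact iff_of_eq (congrArg ULift.down (congrFun (hall i) (g i))).symm

theorem exists_logical_representation (hN : IsElementary ψ N) (he : IsTransversal U N e)
    (hE : ∀ α, Nonempty (E α)) (hψ : ∀ i, (ψ.proj i).IsLogical) :
    ∃ θ : Assignment E, θ.IsLogical ∧ ∀ (σ : Ty S) (x : Name S σ), x.IsEFO →
      Represents U N e σ (θ ⟨σ, x⟩) (ψ ⟨σ, x⟩) := by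
  have hvar (σ : Ty S) (n : ℕ) : ∃ a, Represents U N e σ a (ψ ⟨σ, .var σ n⟩) :=
    (represents_partial_surjection hN he hE σ).2 _ (hN.eval_mem (.name (.var σ n)) .base)
  choose v hv using hvar
  let θ (x : Σ σ : Ty S, Name S σ) : x.1.dom E := match x with
    | ⟨_, .var σ n⟩ => v σ n
    | ⟨_, .neg⟩ => fun a : ULift.{w} Prop => ULift.up (¬ a.down)
    | ⟨_, .imp⟩ => fun a b : ULift.{w} Prop => ULift.up (a.down → b.down)
    | ⟨_, .eq _⟩ => fun a b => ULift.up (a = b)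
    | ⟨_, .all α⟩ => fun f : E α → ULift.{w} Prop => ULift.up (∀ a, (f a).down)
  refine ⟨θ, ⟨rfl, rfl, fun _ => rfl, fun _ => rfl⟩, ?_⟩
  rintro _ (⟨_, n⟩ | _ | _ | σ | α) hx
  · exact hv _ n
  · intro p b _ hp
    have hneg (i : ι) : ψ ⟨_, .neg⟩ i = fun a : ULift.{w} Prop => ULift.up (¬ a.down) := (hψ i).neg
    refine (not_congr hp).trans (Ultrafilter.eventually_not.symm.trans
      (Filter.eventually_congr (.of_forall fun i => ?_)))
    exact iff_of_eq (congrArg ULift.down (congrFun (hneg i) (b i))).symm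
  · intro p b _ hp q c _ hq
    have himp (i : ι) : ψ ⟨_, .imp⟩ i =
      fun a b : ULift.{w} Prop => ULift.up (a.down → b.down) := (hψ i).imp
    refine (imp_congr hp hq).trans (Ultrafilter.eventually_imp.symm.trans
      (Filter.eventually_congr (.of_forall fun i => ?_)))
    exact iff_of_eq (congrArg ULift.down (congrFun (congrFun (himp i) (b i)) (c i))).symm
  · obtain ⟨α, rfl⟩ := hx
    intro a b _ ha a' b' _ ha'
    have heq (i : ι) : ψ ⟨_, .eq (.sort α)⟩ i =
      fun a b : (Ty.sort α).dom (D i) => ULift.up (a = b) := (hψ i).eq _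
    have hiff : a = a' ↔ ∀ᶠ i in (U : Filter ι), b i = b' i := by
      constructor
      · rintro rfl
        exact (almostEqual U _).trans ((almostEqual U _).symm ha) ha'
      · exact fun h => he.inj α a a' ((almostEqual U _).trans
          ((almostEqual U _).trans ha h) ((almostEqual U _).symm ha'))
    refine hiff.trans (Filter.eventually_congr (.of_forall fun i => ?_))
    exact iff_of_eq (congrArg ULift.down (congrFun (congrFun (heq i) (b i)) (b' i))).symm
  · exact represents_all hN he hψ α

end Family

/-- A set of quasi-EFO formulas that are almost everywhere true in a family of standard
interpretations has a standard model with countable domains. -/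
theorem exists_countable_model {S : Type u} [Countable S] {ι : Type*} (U : Ultrafilter ι)
    (J : ι → StandardInterpretation.{u, w} S) {A : Set (Formula S)}
    (hA : ∀ s ∈ A, IsQuasiEFO s)
    (hJ : ∀ s ∈ A, ∀ᶠ i in (U : Filter ι), (s.eval (J i).val : ULift.{w} Prop).down) :
    ∃ I : StandardInterpretation.{u, w} S, I.IsModel A ∧ ∀ α : S, Countable (I.dom α) := by
  let ψ : Valuation fun i => (J i).dom := fun x i => (J i).val x
  have hψ (i : ι) : (ψ.proj i).IsLogical := (J i).logical
  obtain ⟨N, hcount, hN⟩ := exists_countable_isElementary (fun i => (J i).nonempty) ψ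
  choose E e hE hmem hinj hsurj using
    fun α => exists_countable_transversal.{w} (almostEqual U (.sort α)) (hcount (.sort α))
  have he : IsTransversal U N e := ⟨hmem, hinj, hsurj⟩
  have hne (α : S) : Nonempty (E α) :=
    ⟨(hsurj α _ (hN.eval_mem (.name (.var (.sort α) 0)) .base)).choose⟩
  obtain ⟨θ, hlog, hθ⟩ := exists_logical_representation hN he hne hψ
  refine ⟨⟨E, hne, θ, hlog⟩, fun s hs => ?_, hE⟩
  rcases hA s hs with hefo | ⟨σ, t, v, ht, hv, rfl⟩
  · exact (hefo.represents_eval hN .base hθ).2 (hJ s hs)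
  · have hdis {D : S → Type w} {I : Assignment D} (hI : I.IsLogical) :
        ((t.diseq v).eval I : ULift.{w} Prop).down ↔ t.eval I ≠ v.eval I := by
      simp only [Term.diseq, Term.eval, hI.neg, hI.eq]
    refine (hdis hlog).2 fun h => ?_
    have hrt := ht.represents_eval hN .base hθ
    have hrv := hv.represents_eval hN .base hθ
    -- One element now represents both families, so they agree almost everywhere, hence at some
    -- index where the disequation is true.
    rw [← h] at hrv
    have hae := (represents_partial_surjection hN he hne σ).1 _ _ (hN.eval_mem t .base) _
      (hN.eval_mem v .base) hrt hrv
    obtain ⟨i, hi, hi'⟩ := (Filter.Eventually.and hae (hJ _ hs)).exists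
    exact (hdis (hψ i)).1 hi' hi

end STT

/-- Compactness and countable models for EFO branches with respect to standard models. The
normalization operator `nf` is arbitrary; no law about it is assumed. -/
theorem mainTheorem8 {S : Type u} [Countable S]
    (nf : ∀ σ : STT.Ty S, STT.Term S σ → STT.Term S σ)
    (A : Set (STT.Formula S)) (hA : STT.IsEFOBranch nf A)
    (hfin : ∀ F : Set (STT.Formula S), F ⊆ A → F.Finite →
      ∃ I : STT.StandardInterpretation.{u, w} S, I.IsModel F) :
    ∃ I : STT.StandardInterpretation.{u, w} S,
      I.IsModel A ∧ ∀ α : S, Countable (I.dom α) := by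
  -- The index set is the finite subsets of `A`; an ultrafilter below `atTop` contains every cone of
  -- supersets of a singleton, so each member of `A` is true almost everywhere.
  choose J hJ using fun F : Finset A =>
    hfin (Subtype.val '' (F : Set A)) (by simp) (F.finite_toSet.image _)
  refine STT.exists_countable_model (Ultrafilter.of Filter.atTop) J hA.2 fun s hs => ?_
  refine Ultrafilter.of_le _ ((Filter.eventually_ge_atTop {⟨s, hs⟩}).mono fun F hF => ?_)
  exact hJ F s ⟨⟨s, hs⟩, by simpa using hF, rfl⟩
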